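/- Let $X$ be a compact metrizable space (for instance a compact subset of $\mathbb R^n$), $\mu$ a Borel probability measure on $X$, $Y=\{y_1,\dots,y_N\}$ a set of $N$ distinct points, and $c:X\times Y\to\mathbb R$ a cost such that each $c(\cdot,y_j)$ is continuous. Let $\Lambda=\{\lambda\in\mathbb R^N:\lambda^j\ge 0,\ \sum_j\lambda^j=1\}$ and, for $\lambda\in\Lambda$, $\nu_\lambda=\sum_j\lambda^j\delta_{y_j}$; let $\Pi(\mu,\nu_\lambda)$ be the set of measures on $X\times Y$ with marginals $\mu$ and $\nu_\lambda$. Let $F:\mathbb R^N\to\mathbb R\cup\{+\infty\}$ be a proper convex function with $F=+\infty$ outside $\Lambda$, with Legendre transform $F^*(\psi)=\sup_{\lambda\in\mathbb R^N}(\langle\lambda,\psi\rangle-F(\lambda))$. For $\varphi:X\to\mathbb R$ continuous and $\psi\in\mathbb R^N$ put $$(\varphi^c)^j=\sup_{x\in X}\bigl(-c(x,y_j)-\varphi(x)\bigr),\qquad \psi^{c^*}(x)=\max_{1\le j\le N}\bigl(-c(x,y_j)-\psi^j\bigr),\qquad \psi^{c^*c}=(\psi^{c^*})^c .$$ The primal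 problem is to minimize $\int_{X\times Y}c\,d\gamma+F(\lambda)$ over $\lambda\in\Lambda$ and $\gamma\in\Pi(\mu,\nu_\lambda)$. The dual problem is to maximize $-\int_X\varphi\,d\mu-F^*(\psi)$ over $(\varphi,\psi)\in C(X)\times\mathbb R^N$ with $-\varphi(x)-\psi^j\le c(x,y_j)$ for all $x\in X$ and $1\le j\le N$. Suppose $(\tilde\gamma,\tilde\lambda)$ is a minimizing pair in the primal problem. Then for every maximizing pair $(\hat\varphi,\hat\psi)$ in the dual problem, $$-F^*(\hat\psi)=-\langle\tilde\lambda,\hat\psi\rangle+F(\tilde\lambda),$$ that is, equality holds in the Fenchel–Young inequality. Moreover $\hat\psi^j=(\hat\psi^{c^*c})^j$ for every index $1\le j\le N$ with $\tilde\lambda^j>0$. -/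

import Mathlib

open MeasureTheory

noncomputable section

namespace StorageFee

variable {X Y : Type*} {N : ℕ}

/-- The discrete measure `ν_λ = ∑ j, λ^j δ_{y_j}` on `Y`. -/
def targetMeasure [MeasurableSpace Y] (y : Fin N ≃ Y) (lam : Fin N → ℝ) : Measure Y :=
  ∑ j, ENNReal.ofReal (lam j) • Measure.dirac (y j)

/-- `Π(μ, ν)`: the measures on `X × Y` with left marginal `μ` and right marginal `ν`. -/
def couplings [MeasurableSpace X] [MeasurableSpace Y] (μ : Measure X) (ν : Measure Y) :
    Set (Measure (X × Y)) :=
  {γ | γ.map Prod.fst = μ ∧ γ.map Prod.snd = ν}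

/-- Convexity of an extended-real-valued function: its epigraph is convex. -/
def IsConvex (F : (Fin N → ℝ) → EReal) : Prop :=
  Convex ℝ {p : (Fin N → ℝ) × ℝ | F p.1 ≤ (p.2 : EReal)}

/-- A proper function: never `-∞`, and finite somewhere. -/
def IsProper (F : (Fin N → ℝ) → EReal) : Prop :=
  (∀ lam, F lam ≠ ⊥) ∧ ∃ lam, F lam ≠ ⊤

/-- The Legendre transform `F^*(ψ) = sup_{λ ∈ ℝ^N} (⟨λ, ψ⟩ - F(λ))`. -/
def legendre (F : (Fin N → ℝ) → EReal) (ψ : Fin N → ℝ) : EReal :=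
  ⨆ lam : Fin N → ℝ, (((lam ⬝ᵥ ψ : ℝ) : EReal) - F lam)

/-- The transform `φ^c ∈ ℝ^N`, `(φ^c)^j = sup_x (-c(x, y_j) - φ(x))`. -/
def cTransform (c : X × Y → ℝ) (y : Fin N ≃ Y) (φ : X → ℝ) : Fin N → ℝ :=
  fun j => ⨆ x, (-c (x, y j) - φ x)

/-- The transform `ψ^{c^*} : X → ℝ`, `ψ^{c^*}(x) = max_j (-c(x, y_j) - ψ^j)`. -/
def cStarTransform (c : X × Y → ℝ) (y : Fin N ≃ Y) (ψ : Fin N → ℝ) : X → ℝ :=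
  fun x => ⨆ j, (-c (x, y j) - ψ j)

/-- Admissible pairs `(γ, λ)` of the primal problem: `λ` lies in the simplex, `γ ∈ Π(μ, ν_λ)`. -/
def primalAdmissible [MeasurableSpace X] [MeasurableSpace Y] (μ : Measure X) (y : Fin N ≃ Y) :
    Set (Measure (X × Y) × (Fin N → ℝ)) :=
  {p | p.2 ∈ stdSimplex ℝ (Fin N) ∧ p.1 ∈ couplings μ (targetMeasure y p.2)}

/-- The primal objective `∫ c dγ + F(λ)`. -/
def primalObjective [MeasurableSpace X] [MeasurableSpace Y] (c : X × Y → ℝ)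
    (F : (Fin N → ℝ) → EReal) (p : Measure (X × Y) × (Fin N → ℝ)) : EReal :=
  ((∫ z, c z ∂p.1 : ℝ) : EReal) + F p.2

/-- `(γ, λ)` is a minimizing pair in the primal problem. -/
def IsPrimalMinimizer [MeasurableSpace X] [MeasurableSpace Y] (μ : Measure X) (y : Fin N ≃ Y)
    (c : X × Y → ℝ) (F : (Fin N → ℝ) → EReal) (γ : Measure (X × Y)) (lam : Fin N → ℝ) : Prop :=
  (γ, lam) ∈ primalAdmissible μ y ∧
    IsMinOn (primalObjective c F) (primalAdmissible μ y) (γ, lam)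

/-- Admissible pairs `(φ, ψ) ∈ C(X) × ℝ^N` of the dual problem: `-φ - ψ ≤ c`. -/
def dualAdmissible [TopologicalSpace X] (c : X × Y → ℝ) (y : Fin N ≃ Y) :
    Set (C(X, ℝ) × (Fin N → ℝ)) :=
  {q | ∀ x j, -q.1 x - q.2 j ≤ c (x, y j)}

/-- The dual objective `-∫ φ dμ - F^*(ψ)`. -/
def dualObjective [TopologicalSpace X] [MeasurableSpace X] (μ : Measure X)
    (F : (Fin N → ℝ) → EReal) (q : C(X, ℝ) × (Fin N → ℝ)) : EReal :=
  ((-∫ x, q.1 x ∂μ : ℝ) : EReal) - legendre F q.2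

/-- `(φ, ψ)` is a maximizing pair in the dual problem. -/
def IsDualMaximizer [TopologicalSpace X] [MeasurableSpace X] (μ : Measure X) (y : Fin N ≃ Y)
    (c : X × Y → ℝ) (F : (Fin N → ℝ) → EReal) (φ : C(X, ℝ)) (ψ : Fin N → ℝ) : Prop :=
  (φ, ψ) ∈ dualAdmissible c y ∧ IsMaxOn (dualObjective μ F) (dualAdmissible c y) (φ, ψ)

end StorageFee

end

/-! The theorem is complementary slackness once there is no duality gap. Weak duality is a chain of
two inequalities: admissibility integrated against `γ`, and Fenchel–Young for `F`. If the dual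
maximum reaches the primal minimum, both are equalities. The second is the first claim. The first
makes the constraint tight `γ`-almost everywhere, hence somewhere above each `y j` with `lam j > 0`,
which forces `ψ^{c^*c} = ψ` there.

The absence of a gap is `exists_dualAdmissible_le`. Since `F` need not be lower semicontinuous, it
is obtained by perturbation: let the weights in `F` and the second marginal of the plan differ by
`d`. Rerouting mass (`exists_stochastic_matrix`, `IsPlan.exists_mass_eq`) shows that the value drops
at most linearly in `‖d‖`, so Hahn–Banach (`exists_supporting_functional`) gives a nonvertical
supporting hyperplane at `d = 0`. Its slope is the dual `ψ`, paired with `φ = ψ^{c^*}`. Plans are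
taken as densities `h j` on `X`, since the target is finite. -/

open MeasureTheory

namespace StorageFee

/-! ### Rerouting mass between two points of the simplex -/

section Stochastic

variable {N : ℕ}

/-- Two points of the simplex are related by a stochastic matrix that moves little mass. -/
theorem exists_stochastic_matrix {a b : Fin N → ℝ} (ha : a ∈ stdSimplex ℝ (Fin N))
    (hb : b ∈ stdSimplex ℝ (Fin N)) :
    ∃ K : Fin N → Fin N → ℝ, (∀ i j, 0 ≤ K i j) ∧ (∀ i, ∑ j, K i j = 1) ∧
      (∀ j, ∑ i, a i * K i j = b j) ∧ ∑ i, a i * (1 - K i i) ≤ ∑ i, |b i - a i| := by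
  -- Total deficit of `a` relative to `b`; it equals the total excess because both sum to one.
  set S : ℝ := ∑ i, max (b i - a i) 0 with hS
  have hS' : ∑ i, (a i - min (a i) (b i)) = S := by
    have h : ∀ i, a i - min (a i) (b i) = max (b i - a i) 0 - (b i - a i) := fun i => by
      rcases le_total (a i) (b i) with h | h
      · rw [min_eq_left h, max_eq_left (by linarith)]; ring
      · rw [min_eq_right h, max_eq_right (by linarith)]; ring
    simp only [h, Finset.sum_sub_distrib, ha.2, hb.2]
    ring
  have hS0 : 0 ≤ S := Finset.sum_nonneg fun i _ => le_max_right _ _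
  rcases hS0.eq_or_lt with h0 | hpos
  · have hle : ∀ i, b i - a i ≤ 0 := fun i => by
      have h := (Finset.sum_eq_zero_iff_of_nonneg (fun i _ => le_max_right (b i - a i) 0)).1 h0.symm
        i (Finset.mem_univ i)
      exact (le_max_left _ _).trans h.le
    have heq : ∀ i, b i = a i := fun i => by
      have hs : ∑ i, (b i - a i) = 0 := by rw [Finset.sum_sub_distrib, ha.2, hb.2, sub_self]
      have := (Finset.sum_eq_zero_iff_of_nonpos (fun i _ => hle i)).1 hs i (Finset.mem_univ i)
      linarith
    refine ⟨fun i j => if i = j then 1 else 0, fun i j => ?_, fun i => by simp, fun j => ?_, ?_⟩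
    · dsimp only; split_ifs <;> norm_num
    · simp [heq]
    · simp [heq]
  -- Index `i` keeps the share `r i` of its mass and releases the rest, which `q` distributes in
  -- proportion to the deficits. If `a i = 0` then `r i = 0`, and row `i` is just `q`.
  · set r : Fin N → ℝ := fun i => min (a i) (b i) / a i with hr
    have hr0 : ∀ i, 0 ≤ r i := fun i => div_nonneg (le_min (ha.1 i) (hb.1 i)) (ha.1 i)
    have hr1 : ∀ i, r i ≤ 1 := fun i => div_le_one_of_le₀ (min_le_left _ _) (ha.1 i)
    have har : ∀ i, a i * r i = min (a i) (b i) := fun i => by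
      rcases (ha.1 i).eq_or_lt with h | h
      · rw [← h, min_eq_left (hb.1 i), zero_mul]
      · exact mul_div_cancel₀ _ h.ne'
    set q : Fin N → ℝ := fun j => max (b j - a j) 0 / S with hq
    have hq0 : ∀ j, 0 ≤ q j := fun j => div_nonneg (le_max_right _ _) hS0
    have hq1 : ∑ j, q j = 1 := by rw [hq, ← Finset.sum_div, ← hS, div_self hpos.ne']
    refine ⟨fun i j => (if i = j then r i else 0) + (1 - r i) * q j, fun i j => ?_, fun i => ?_,
      fun j => ?_, ?_⟩
    · have := mul_nonneg (sub_nonneg.2 (hr1 i)) (hq0 j)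
      dsimp only
      split_ifs
      · linarith [hr0 i]
      · linarith
    · rw [Finset.sum_add_distrib, ← Finset.mul_sum, hq1]
      simp
    · have h : ∀ i, a i * ((if i = j then r i else 0) + (1 - r i) * q j) =
          (if i = j then min (a i) (b i) else 0) + (a i - min (a i) (b i)) * q j := fun i => by
        rw [← har i]
        split_ifs <;> ring
      rw [Finset.sum_congr rfl fun i _ => h i, Finset.sum_add_distrib, ← Finset.sum_mul, hS',
        Finset.sum_ite_eq', if_pos (Finset.mem_univ j), mul_div_cancel₀ _ hpos.ne']
      rcases le_total (a j) (b j) with h | h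
      · rw [min_eq_left h, max_eq_left (by linarith)]; ring
      · rw [min_eq_right h, max_eq_right (by linarith)]; ring
    · refine Finset.sum_le_sum fun i _ => ?_
      have h1 : a i * (1 - ((if i = i then r i else 0) + (1 - r i) * q i)) ≤
          a i * (1 - r i) := by
        have := mul_nonneg (sub_nonneg.2 (hr1 i)) (hq0 i)
        rw [if_pos rfl]
        exact mul_le_mul_of_nonneg_left (by linarith) (ha.1 i)
      refine h1.trans ?_
      rw [mul_sub, har, mul_one]
      rcases le_total (a i) (b i) with h | h
      · rw [min_eq_left h]; simp
      · rw [min_eq_right h, abs_sub_comm]; exact le_abs_self _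

end Stochastic

/-! ### Transport plans as densities -/

section Plans

variable {X Y : Type*} {N : ℕ} [MeasurableSpace X]

/-- Measurable families of nonnegative weights with sum one: the densities of transport plans onto
a finite target. -/
structure IsPlan (h : Fin N → X → ℝ) : Prop where
  measurable : ∀ j, Measurable (h j)
  nonneg : ∀ j x, 0 ≤ h j x
  sum_eq_one : ∀ x, ∑ j, h j x = 1

/-- The weights of the second marginal of a plan. -/
noncomputable def mass (μ : Measure X) (h : Fin N → X → ℝ) : Fin N → ℝ := fun j => ∫ x, h j x ∂μ

/-- The cost of a plan. -/
noncomputable def cost (μ : Measure X) (k : Fin N → X → ℝ) (h : Fin N → X → ℝ) : ℝ :=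
  ∑ j, ∫ x, k j x * h j x ∂μ

theorem IsPlan.le_one {h : Fin N → X → ℝ} (hh : IsPlan h) (j : Fin N) (x : X) : h j x ≤ 1 := by
  rw [← hh.sum_eq_one x]
  exact Finset.single_le_sum (f := fun j => h j x) (fun i _ => hh.nonneg i x) (Finset.mem_univ j)

theorem IsPlan.integrable {h : Fin N → X → ℝ} (hh : IsPlan h) (μ : Measure X) [IsFiniteMeasure μ]
    (j : Fin N) : Integrable (h j) μ :=
  Integrable.of_bound (hh.measurable j).aestronglyMeasurable 1
    (.of_forall fun x => by rw [Real.norm_of_nonneg (hh.nonneg j x)]; exact hh.le_one j x)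

theorem IsPlan.integrable_mul {h : Fin N → X → ℝ} (hh : IsPlan h) (μ : Measure X)
    [IsFiniteMeasure μ] {f : X → ℝ} (hf : Measurable f) {M : ℝ} (hM : ∀ x, |f x| ≤ M)
    (j : Fin N) : Integrable (fun x => f x * h j x) μ :=
  (hh.integrable μ j).bdd_mul hf.aestronglyMeasurable (.of_forall hM)

theorem IsPlan.mass_mem_stdSimplex {h : Fin N → X → ℝ} (hh : IsPlan h) (μ : Measure X)
    [IsProbabilityMeasure μ] : mass μ h ∈ stdSimplex ℝ (Fin N) := by
  refine ⟨fun j => integral_nonneg (hh.nonneg j), ?_⟩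
  simp only [mass]
  rw [← integral_finsetSum _ fun j _ => hh.integrable μ j]
  simp [hh.sum_eq_one]

theorem isPlan_const {a : Fin N → ℝ} (ha : a ∈ stdSimplex ℝ (Fin N)) :
    IsPlan (fun j (_ : X) => a j) :=
  ⟨fun _ => measurable_const, fun j _ => ha.1 j, fun _ => ha.2⟩

theorem IsPlan.convexComb {h g : Fin N → X → ℝ} (hh : IsPlan h) (hg : IsPlan g) {s t : ℝ}
    (hs : 0 ≤ s) (ht : 0 ≤ t) (hst : s + t = 1) : IsPlan (fun j x => s * h j x + t * g j x) where
  measurable j := ((hh.measurable j).const_mul s).add ((hg.measurable j).const_mul t)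
  nonneg j x := add_nonneg (mul_nonneg hs (hh.nonneg j x)) (mul_nonneg ht (hg.nonneg j x))
  sum_eq_one x := by
    rw [Finset.sum_add_distrib, ← Finset.mul_sum, ← Finset.mul_sum, hh.sum_eq_one, hg.sum_eq_one,
      mul_one, mul_one, hst]

theorem IsPlan.mass_convexComb {h g : Fin N → X → ℝ} (hh : IsPlan h) (hg : IsPlan g)
    (μ : Measure X) [IsFiniteMeasure μ] (s t : ℝ) :
    mass μ (fun j x => s * h j x + t * g j x) = s • mass μ h + t • mass μ g := by
  ext j
  simp only [mass, Pi.add_apply, Pi.smul_apply, smul_eq_mul]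
  rw [integral_add ((hh.integrable μ j).const_mul s) ((hg.integrable μ j).const_mul t),
    integral_const_mul, integral_const_mul]

theorem IsPlan.cost_convexComb {h g : Fin N → X → ℝ} (hh : IsPlan h) (hg : IsPlan g)
    (μ : Measure X) [IsFiniteMeasure μ] {k : Fin N → X → ℝ} (hk : ∀ j, Measurable (k j)) {M : ℝ}
    (hM : ∀ j x, |k j x| ≤ M) (s t : ℝ) :
    cost μ k (fun j x => s * h j x + t * g j x) = s * cost μ k h + t * cost μ k g := by
  simp only [cost, Finset.mul_sum, ← Finset.sum_add_distrib]
  refine Finset.sum_congr rfl fun j _ => ?_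
  rw [← integral_const_mul, ← integral_const_mul,
    ← integral_add ((hh.integrable_mul μ (hk j) (hM j) j).const_mul s)
      ((hg.integrable_mul μ (hk j) (hM j) j).const_mul t)]
  exact integral_congr_ae (.of_forall fun x => by dsimp only; ring)

/-- The optimal cost is Lipschitz in the weights of the target measure. -/
theorem IsPlan.exists_mass_eq {h : Fin N → X → ℝ} (hh : IsPlan h) (μ : Measure X)
    [IsProbabilityMeasure μ] {k : Fin N → X → ℝ} (hk : ∀ j, Measurable (k j)) {M : ℝ}
    (hM : ∀ j x, |k j x| ≤ M) {b : Fin N → ℝ} (hb : b ∈ stdSimplex ℝ (Fin N)) :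
    ∃ g, IsPlan g ∧ mass μ g = b ∧
      cost μ k g ≤ cost μ k h + 2 * M * ∑ j, |b j - mass μ h j| := by
  obtain ⟨K, hK0, hK1, hKb, hKd⟩ := exists_stochastic_matrix (hh.mass_mem_stdSimplex μ) hb
  have hint := fun i j => hh.integrable_mul μ (hk i) (hM i) j
  refine ⟨fun j x => ∑ i, h i x * K i j, ⟨fun j => ?_, fun j x => ?_, fun x => ?_⟩, ?_, ?_⟩
  · exact Finset.measurable_sum _ fun i _ => (hh.measurable i).mul_const _
  · exact Finset.sum_nonneg fun i _ => mul_nonneg (hh.nonneg i x) (hK0 i j)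
  · rw [Finset.sum_comm]
    simp only [← Finset.mul_sum, hK1, mul_one, hh.sum_eq_one]
  · ext j
    rw [← hKb j]
    simp only [mass]
    rw [integral_finsetSum _ fun i _ => (hh.integrable μ i).mul_const _]
    simp only [integral_mul_const]
  -- The sign of `M` comes from evaluating the bound at a point; an index exists since the weights
  -- of a plan cannot sum to one over an empty set.
  · have hM0 : 0 ≤ M := by
      obtain ⟨x⟩ := nonempty_of_isProbabilityMeasure μ
      have : ∃ j : Fin N, True := by
        by_contra! hne
        have := hh.sum_eq_one x
        rw [Finset.sum_eq_zero fun j _ => (hne j).elim] at this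
        norm_num at this
      obtain ⟨j, -⟩ := this
      exact (abs_nonneg _).trans (hM j x)
    have e1 : cost μ k (fun j x => ∑ i, h i x * K i j) =
        ∑ i, ∑ j, K i j * ∫ x, k j x * h i x ∂μ := by
      rw [Finset.sum_comm]
      refine Finset.sum_congr rfl fun j _ => ?_
      simp only [← integral_const_mul]
      rw [← integral_finsetSum _ fun i _ => (hint j i).const_mul _]
      refine integral_congr_ae (.of_forall fun x => ?_)
      dsimp only
      rw [Finset.mul_sum]
      exact Finset.sum_congr rfl fun i _ => by ring
    have e2 : ∀ i j, ∫ x, k j x * h i x ∂μ ≤ ∫ x, k i x * h i x ∂μ + 2 * M * mass μ h i := by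
      intro i j
      rw [mass, ← integral_const_mul, ← integral_add (hint i i) ((hh.integrable μ i).const_mul _)]
      refine integral_mono (hint j i) ((hint i i).add ((hh.integrable μ i).const_mul _)) fun x => ?_
      dsimp only [Pi.add_apply]
      rw [← add_mul]
      exact mul_le_mul_of_nonneg_right
        (by linarith [abs_le.1 (hM i x), abs_le.1 (hM j x)]) (hh.nonneg i x)
    have e3 : ∀ i, ∑ j, K i j * ∫ x, k j x * h i x ∂μ ≤
        ∫ x, k i x * h i x ∂μ + 2 * M * (mass μ h i * (1 - K i i)) := by
      intro i
      set A := ∫ x, k i x * h i x ∂μ with hA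
      -- Rerouting costs at most `2 * M` per unit of mass; the subtracted diagonal term refunds this
      -- charge for mass that stays at `i`.
      have hle : ∀ j, K i j * ∫ x, k j x * h i x ∂μ ≤
          K i j * (A + 2 * M * mass μ h i) - if j = i then K i i * (2 * M * mass μ h i) else 0 := by
        intro j
        split_ifs with hij
        · subst hij; rw [← hA]; apply le_of_eq; ring
        · rw [sub_zero]; exact mul_le_mul_of_nonneg_left (e2 i j) (hK0 i j)
      refine (Finset.sum_le_sum fun j _ => hle j).trans (le_of_eq ?_)
      rw [Finset.sum_sub_distrib, ← Finset.sum_mul, hK1]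
      simp only [Finset.sum_ite_eq', Finset.mem_univ, if_true]
      ring
    rw [e1]
    refine (Finset.sum_le_sum fun i _ => e3 i).trans ?_
    rw [Finset.sum_add_distrib, ← Finset.mul_sum]
    exact add_le_add le_rfl (mul_le_mul_of_nonneg_left hKd (by positivity))

variable [MeasurableSpace Y]

/-- The measure on the product with the given densities. -/
noncomputable def planMeasure (μ : Measure X) (y : Fin N ≃ Y) (h : Fin N → X → ℝ) :
    Measure (X × Y) :=
  ∑ j, (μ.withDensity fun x => ENNReal.ofReal (h j x)).map fun x => (x, y j)

theorem IsPlan.planMeasure_mem_couplings {h : Fin N → X → ℝ} (hh : IsPlan h) (μ : Measure X)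
    [IsFiniteMeasure μ] (y : Fin N ≃ Y) :
    planMeasure μ y h ∈ couplings μ (targetMeasure y (mass μ h)) := by
  have hm : ∀ j, Measurable fun x : X => (x, y j) := fun j => measurable_id.prodMk measurable_const
  constructor
  · ext s hs
    rw [Measure.map_apply measurable_fst hs, planMeasure, Measure.finsetSum_apply]
    have : ∀ j, ((μ.withDensity fun x => ENNReal.ofReal (h j x)).map fun x => (x, y j))
        (Prod.fst ⁻¹' s) = ∫⁻ x in s, ENNReal.ofReal (h j x) ∂μ := fun j => by
      rw [Measure.map_apply (hm j) (measurable_fst hs), withDensity_apply _ (hm j (measurable_fst hs))]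
      rfl
    simp only [this]
    rw [← lintegral_finsetSum _ fun j _ => (hh.measurable j).ennreal_ofReal]
    have : ∀ x, ∑ j, ENNReal.ofReal (h j x) = 1 := fun x => by
      rw [← ENNReal.ofReal_sum_of_nonneg fun j _ => hh.nonneg j x, hh.sum_eq_one, ENNReal.ofReal_one]
    simp [this]
  · ext s hs
    rw [Measure.map_apply measurable_snd hs, planMeasure, targetMeasure, Measure.finsetSum_apply,
      Measure.finsetSum_apply]
    refine Finset.sum_congr rfl fun j _ => ?_
    rw [Measure.map_apply (hm j) (measurable_snd hs), withDensity_apply _ (hm j (measurable_snd hs)),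
      Measure.smul_apply, Measure.dirac_apply' _ hs, smul_eq_mul, mass,
      ofReal_integral_eq_lintegral_ofReal (hh.integrable μ j) (.of_forall (hh.nonneg j))]
    by_cases hj : y j ∈ s
    · have : (fun x : X => (x, y j)) ⁻¹' (Prod.snd ⁻¹' s) = Set.univ := by ext; simp [hj]
      simp [this, hj]
    · have : (fun x : X => (x, y j)) ⁻¹' (Prod.snd ⁻¹' s) = ∅ := by ext; simp [hj]
      simp [this, hj]

theorem IsPlan.integral_planMeasure {h : Fin N → X → ℝ} (hh : IsPlan h) (μ : Measure X)
    [IsFiniteMeasure μ] (y : Fin N ≃ Y) {c : X × Y → ℝ} (hc : Measurable c) {M : ℝ}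
    (hM : ∀ z, |c z| ≤ M) :
    ∫ z, c z ∂planMeasure μ y h = cost μ (fun j x => c (x, y j)) h := by
  have hm : ∀ j, Measurable fun x : X => (x, y j) := fun j => measurable_id.prodMk measurable_const
  have hfin : ∀ j, IsFiniteMeasure (μ.withDensity fun x => ENNReal.ofReal (h j x)) := fun j =>
    isFiniteMeasure_withDensity_ofReal (hh.integrable μ j).2
  rw [planMeasure, integral_finsetSum_measure, cost]
  · refine Finset.sum_congr rfl fun j _ => ?_
    rw [integral_map (hm j).aemeasurable hc.aestronglyMeasurable,
      integral_withDensity_eq_integral_toReal_smul (hh.measurable j).ennreal_ofReal (by simp)]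
    refine integral_congr_ae (.of_forall fun x => ?_)
    dsimp only
    rw [ENNReal.toReal_ofReal (hh.nonneg j x), smul_eq_mul, mul_comm]
  · intro j _
    have := hfin j
    exact Integrable.of_bound hc.aestronglyMeasurable M (.of_forall hM)

end Plans

/-! ### Supporting hyperplane from a cone bound -/

section Separation

variable {N : ℕ}

/-- A convex set above a downward cone is supported from below by a nonvertical hyperplane at the
apex. -/
theorem exists_supporting_functional {D : Set ((Fin N → ℝ) × ℝ)} (hD : Convex ℝ D)
    (hne : D.Nonempty) {P L : ℝ} (hL : 0 ≤ L) (hcone : ∀ p ∈ D, P - L * ‖p.1‖ ≤ p.2) :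
    ∃ ψ : Fin N → ℝ, ∀ p ∈ D, P ≤ p.2 - p.1 ⬝ᵥ ψ := by
  -- The open downward cone with apex `(0, P)`. Having points over every base point, it rules out a
  -- vertical hyperplane.
  set C : Set ((Fin N → ℝ) × ℝ) := {p | L * ‖p.1‖ + p.2 < P} with hC
  have hCconv : Convex ℝ C := by
    have h1 : ConvexOn ℝ Set.univ fun p : (Fin N → ℝ) × ℝ => L * ‖p.1‖ + p.2 :=
      (((convexOn_norm convex_univ).comp_linearMap (LinearMap.fst ℝ (Fin N → ℝ) ℝ)).smul hL).add
        ((LinearMap.snd ℝ (Fin N → ℝ) ℝ).convexOn convex_univ)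
    simpa using h1.convex_lt P
  have hCopen : IsOpen C := isOpen_lt (by fun_prop) continuous_const
  have hdisj : Disjoint C D := Set.disjoint_left.2 fun p hp hpD => by
    have := hcone p hpD
    simp only [hC, Set.mem_ofPred_eq] at hp
    linarith
  obtain ⟨f, u, hfC, hfD⟩ := geometric_hahn_banach_open hCconv hCopen hD hdisj
  set s : ℝ := f (0, 1) with hs
  set a : Fin N → ℝ := fun j => f (Pi.single j 1, 0) with ha
  have hf : ∀ p : (Fin N → ℝ) × ℝ, f p = p.1 ⬝ᵥ a + p.2 * s := by
    intro p
    have e : p = (∑ j, p.1 j • ((Pi.single j 1 : Fin N → ℝ), (0 : ℝ))) + p.2 • ((0 : Fin N → ℝ), (1 : ℝ)) := by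
      refine Prod.ext ?_ ?_
      · ext i
        simp [Prod.fst_sum, Pi.single_apply]
      · simp [Prod.snd_sum]
    conv_lhs => rw [e]
    rw [map_add, map_sum, map_smul]
    simp only [map_smul, smul_eq_mul, dotProduct, ha, hs]
  have hbound : ∀ d : Fin N → ℝ, ∀ t, L * ‖d‖ + t < P → d ⬝ᵥ a + t * s < u := fun d t h => by
    have := hfC (d, t) h
    rwa [hf] at this
  have hD' : ∀ p ∈ D, u ≤ p.1 ⬝ᵥ a + p.2 * s := fun p hp => by rw [← hf]; exact hfD p hp
  have hspos : 0 < s := by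
    obtain ⟨p, hp⟩ := hne
    have h1 := hD' p hp
    -- A point of `C` strictly below `p` on the same vertical line.
    have h2 := hbound p.1 (min (P - L * ‖p.1‖) p.2 - 1) (by
      linarith [min_le_left (P - L * ‖p.1‖) p.2])
    have h3 : min (P - L * ‖p.1‖) p.2 - 1 < p.2 := by linarith [min_le_right (P - L * ‖p.1‖) p.2]
    by_contra! hneg
    have := mul_le_mul_of_nonpos_right h3.le hneg
    linarith
  have hu : P * s ≤ u := by
    by_contra! hlt
    have h1 : u / s < P := (div_lt_iff₀ hspos).2 hlt
    have h2 := hbound 0 (u / s) (by simpa using h1)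
    rw [zero_dotProduct, div_mul_cancel₀ _ hspos.ne', zero_add] at h2
    exact lt_irrefl _ h2
  refine ⟨-(s⁻¹ • a), fun p hp => ?_⟩
  have h1 := hu.trans (hD' p hp)
  rw [dotProduct_neg, dotProduct_smul, smul_eq_mul]
  have h2 : P ≤ (p.1 ⬝ᵥ a + p.2 * s) / s := (le_div_iff₀ hspos).2 h1
  have h3 : (p.1 ⬝ᵥ a + p.2 * s) / s = p.2 - -(s⁻¹ * p.1 ⬝ᵥ a) := by field_simp; ring
  linarith

end Separation

/-! ### The transforms and their maximizers -/

section Transform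

variable {X Y : Type*} {N : ℕ}

theorem le_cStarTransform (c : X × Y → ℝ) (y : Fin N ≃ Y) (ψ : Fin N → ℝ) (x : X) (j : Fin N) :
    -c (x, y j) - ψ j ≤ cStarTransform c y ψ x :=
  le_ciSup (f := fun j => -c (x, y j) - ψ j) (Set.finite_range _).bddAbove j

theorem continuous_cStarTransform [TopologicalSpace X] [Nonempty (Fin N)] {c : X × Y → ℝ}
    {y : Fin N ≃ Y} (hc : ∀ j, Continuous fun x => c (x, y j)) (ψ : Fin N → ℝ) :
    Continuous (cStarTransform c y ψ) := by
  have : cStarTransform c y ψ = fun x =>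
      Finset.univ.sup' Finset.univ_nonempty fun j => -c (x, y j) - ψ j := by
    ext x
    rw [Finset.sup'_univ_eq_ciSup]
    rfl
  rw [this]
  exact Continuous.finset_sup'_apply _ fun j _ => ((hc j).neg.sub continuous_const)

/-- The plan that splits each point evenly among the maximizers in `ψ^{c^*}`. -/
theorem exists_isPlan_argmax [MeasurableSpace X] [Nonempty (Fin N)] {c : X × Y → ℝ}
    {y : Fin N ≃ Y} (hc : ∀ j, Measurable fun x => c (x, y j)) (ψ : Fin N → ℝ)
    (hψ : Measurable (cStarTransform c y ψ)) :
    ∃ h : Fin N → X → ℝ, IsPlan h ∧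
      ∀ x, ∑ j, (c (x, y j) + ψ j) * h j x = -cStarTransform c y ψ x := by
  classical
  set A : Fin N → Set X := fun j => {x | -c (x, y j) - ψ j = cStarTransform c y ψ x} with hA
  have hAm : ∀ j, MeasurableSet (A j) := fun j =>
    measurableSet_eq_fun ((hc j).neg.sub_const _) hψ
  -- The number of maximizers at `x`; even splitting avoids a measurable selection.
  set n : X → ℝ := fun x => ∑ j, (A j).indicator 1 x with hn
  have hn0 : ∀ x, 0 < n x := fun x => by
    obtain ⟨j, hj⟩ := exists_eq_ciSup_of_finite (f := fun j => -c (x, y j) - ψ j)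
    refine Finset.sum_pos' (fun i _ => Set.indicator_nonneg (fun _ _ => zero_le_one) _)
      ⟨j, Finset.mem_univ j, ?_⟩
    rw [Set.indicator_of_mem (show x ∈ A j from hj)]
    exact zero_lt_one
  have h1 : ∀ x, ∑ j, (A j).indicator (1 : X → ℝ) x / n x = 1 := fun x => by
    rw [← Finset.sum_div]
    exact div_self (hn0 x).ne'
  have hAi : ∀ j, Measurable ((A j).indicator (1 : X → ℝ)) := fun j =>
    measurable_one.indicator (hAm j)
  refine ⟨fun j x => (A j).indicator 1 x / n x, ⟨fun j => ?_, fun j x => ?_, h1⟩, fun x => ?_⟩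
  · exact (hAi j).div (Finset.measurable_sum _ fun i _ => hAi i)
  · exact div_nonneg (Set.indicator_nonneg (fun _ _ => zero_le_one) _) (hn0 x).le
  · rw [← mul_one (-cStarTransform c y ψ x), ← h1 x, Finset.mul_sum]
    refine Finset.sum_congr rfl fun j _ => ?_
    by_cases hx : x ∈ A j
    · have : -c (x, y j) - ψ j = cStarTransform c y ψ x := hx
      rw [← this]
      ring
    · simp [Set.indicator_of_notMem hx]

/-- A dual pair that touches the constraint at `y_j` has `ψ^j = (ψ^{c^*c})^j`. -/
theorem eq_cTransform_cStarTransform {c : X × Y → ℝ} {y : Fin N ≃ Y} {φ : X → ℝ}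
    {ψ : Fin N → ℝ} (hadm : ∀ x j, -φ x - ψ j ≤ c (x, y j)) {j : Fin N} {x : X}
    (hx : -φ x - ψ j = c (x, y j)) :
    ψ j = cTransform c y (cStarTransform c y ψ) j := by
  have hle : ∀ x, -c (x, y j) - cStarTransform c y ψ x ≤ ψ j := fun x => by
    linarith [le_cStarTransform c y ψ x j]
  have : Nonempty X := ⟨x⟩
  have : Nonempty (Fin N) := ⟨j⟩
  refine le_antisymm ?_ (ciSup_le hle)
  -- With `ψ^{c^*} ≤ φ`, tightness at `x` pushes the supremum over `X` up to `ψ j`.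
  have h1 : cStarTransform c y ψ x ≤ φ x := ciSup_le fun i => by linarith [hadm x i]
  refine le_trans ?_ (le_ciSup (f := fun x => -c (x, y j) - cStarTransform c y ψ x)
    ⟨ψ j, Set.forall_mem_range.2 hle⟩ x)
  linarith

end Transform

/-! ### Strong duality with attainment -/

section Duality

variable {X Y : Type*} {N : ℕ} [TopologicalSpace X] [MeasurableSpace X] [BorelSpace X]

/-- If `P` bounds the primal values of all plans from below, then some dual pair has value at
least `P`. -/
theorem exists_dualAdmissible_le (μ : Measure X) [IsProbabilityMeasure μ] (y : Fin N ≃ Y)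
    {c : X × Y → ℝ} (hc : ∀ j, Continuous fun x => c (x, y j)) {M : ℝ} (hM : ∀ z, |c z| ≤ M)
    {F : (Fin N → ℝ) → EReal} (hF_convex : IsConvex F) (hF_proper : IsProper F)
    (hF_dom : ∀ lam, lam ∉ stdSimplex ℝ (Fin N) → F lam = ⊤) {P : ℝ}
    (hP : ∀ h : Fin N → X → ℝ, IsPlan h → ∀ t : ℝ, F (mass μ h) ≤ t →
      P ≤ cost μ (fun j x => c (x, y j)) h + t) :
    ∃ q ∈ dualAdmissible c y, (P : EReal) ≤ dualObjective μ F q := by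
  set k : Fin N → X → ℝ := fun j x => c (x, y j) with hk
  have hkm : ∀ j, Measurable (k j) := fun j => (hc j).measurable
  have hkM : ∀ j x, |k j x| ≤ M := fun j x => hM _
  have hmem : ∀ {l : Fin N → ℝ} {t : ℝ}, F l ≤ t → l ∈ stdSimplex ℝ (Fin N) := fun {l t} h => by
    by_contra hl
    rw [hF_dom l hl] at h
    exact absurd (top_le_iff.1 h) (EReal.coe_ne_top t)
  obtain ⟨l₀, hl₀⟩ := hF_proper.2
  have hFl₀ : F l₀ ≤ ((F l₀).toReal : EReal) := EReal.le_coe_toReal hl₀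
  have hl₀s := hmem hFl₀
  have hN : Nonempty (Fin N) := by
    by_contra hne
    rw [not_nonempty_iff] at hne
    have := hl₀s.2
    simp at this
  have hX : Nonempty X := nonempty_of_isProbabilityMeasure μ
  have hM0 : 0 ≤ M := (abs_nonneg _).trans (hkM hN.some hX.some)
  -- Here `l` and `h` are decoupled; the primal problem is the fibre over first coordinate `0`.
  set D : Set ((Fin N → ℝ) × ℝ) := {p | ∃ l t h, F l ≤ (t : ℝ) ∧ IsPlan h ∧
    p = (l - mass μ h, t + cost μ k h)} with hDdef
  have hDconv : Convex ℝ D := by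
    rintro _ ⟨l, t, h, hl, hh, rfl⟩ _ ⟨l', t', h', hl', hh', rfl⟩ a b ha hb hab
    refine ⟨a • l + b • l', a * t + b * t', fun j x => a * h j x + b * h' j x, ?_,
      hh.convexComb hh' ha hb hab, ?_⟩
    · exact hF_convex (x := (l, t)) hl (y := (l', t')) hl' ha hb hab
    · rw [hh.mass_convexComb hh' μ, hh.cost_convexComb hh' μ hkm hkM]
      refine Prod.ext ?_ ?_
      · simp only [Prod.smul_mk, Prod.mk_add_mk, smul_sub]
        abel
      · simp only [Prod.smul_mk, Prod.mk_add_mk, smul_eq_mul]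
        ring
  have hDne : D.Nonempty := ⟨_, l₀, _, _, hFl₀, isPlan_const hl₀s, rfl⟩
  -- Move the plan onto the weights `l`, where `hP` applies. The factor `2 * M` is the rerouting
  -- cost, and `N` passes from the sum norm to the sup norm.
  have hcone : ∀ p ∈ D, P - 2 * M * N * ‖p.1‖ ≤ p.2 := by
    rintro _ ⟨l, t, h, hl, hh, rfl⟩
    obtain ⟨g, hg, hgm, hgc⟩ := hh.exists_mass_eq μ hkm hkM (hmem hl)
    have h1 := hP g hg t (by rwa [hgm])
    have h2 : ∑ j, |l j - mass μ h j| ≤ N * ‖l - mass μ h‖ := by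
      refine (Finset.sum_le_card_nsmul _ _ ‖l - mass μ h‖ fun j _ =>
        norm_le_pi_norm (l - mass μ h) j).trans (le_of_eq (by simp))
    have h3 := mul_le_mul_of_nonneg_left h2 (mul_nonneg zero_le_two hM0)
    dsimp only
    linarith
  obtain ⟨ψ, hψ⟩ := exists_supporting_functional hDconv hDne (by positivity) hcone
  have hcont := continuous_cStarTransform hc ψ
  -- This plan satisfies `cost + ⟨mass, ψ⟩ = -∫ ψ^{c^*}`. Keeping it fixed in the supporting
  -- inequality while `l` varies bounds `F^*(ψ)`.
  obtain ⟨h, hh, hhψ⟩ := exists_isPlan_argmax hkm ψ hcont.measurable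
  have hval : cost μ k h + mass μ h ⬝ᵥ ψ = -∫ x, cStarTransform c y ψ x ∂μ := by
    rw [← integral_neg]
    simp only [← hhψ]
    have hi : ∀ j, Integrable (fun x => k j x * h j x) μ := fun j =>
      hh.integrable_mul μ (hkm j) (hkM j) j
    have hi' : ∀ j, Integrable (fun x => (c (x, y j) + ψ j) * h j x) μ := fun j => by
      simp only [add_mul]
      exact (hi j).add ((hh.integrable μ j).const_mul (ψ j))
    rw [integral_finsetSum _ fun j _ => hi' j, cost, dotProduct, ← Finset.sum_add_distrib]
    refine Finset.sum_congr rfl fun j _ => ?_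
    simp only [add_mul]
    rw [integral_add (hi j) ((hh.integrable μ j).const_mul (ψ j)), integral_const_mul, mass,
      mul_comm (ψ j)]
  refine ⟨(⟨cStarTransform c y ψ, hcont⟩, ψ), fun x j => ?_, ?_⟩
  · have := le_cStarTransform c y ψ x j
    simp only [ContinuousMap.coe_mk]
    linarith
  · have hleg : legendre F ψ ≤ ((-(∫ x, cStarTransform c y ψ x ∂μ) - P : ℝ) : EReal) := by
      refine iSup_le fun l => ?_
      rcases eq_or_ne (F l) ⊤ with hl | hl
      · rw [hl, EReal.sub_top]
        exact bot_le
      · have hFl := EReal.coe_toReal hl (hF_proper.1 l)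
        have h1 := hψ _ ⟨l, (F l).toReal, h, hFl.ge, hh, rfl⟩
        rw [sub_dotProduct] at h1
        rw [← hFl, ← EReal.coe_sub, EReal.coe_le_coe_iff]
        linarith
    calc (P : EReal) = ((-∫ x, cStarTransform c y ψ x ∂μ : ℝ) : EReal) -
          ((-(∫ x, cStarTransform c y ψ x ∂μ) - P : ℝ) : EReal) := by
            rw [← EReal.coe_sub]; congr 1; ring
      _ ≤ _ := EReal.sub_le_sub le_rfl hleg

end Duality

/-! ### Weak duality and complementary slackness -/

section Coupling

variable {X Y : Type*} {N : ℕ} [MeasurableSpace X] [MeasurableSpace Y]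
  [MeasurableSingletonClass Y]

theorem integral_targetMeasure (y : Fin N ≃ Y) {lam : Fin N → ℝ} (hlam : ∀ j, 0 ≤ lam j)
    (ψ : Fin N → ℝ) : ∫ z, ψ (y.symm z) ∂targetMeasure y lam = lam ⬝ᵥ ψ := by
  rw [targetMeasure, integral_finsetSum_measure, dotProduct]
  · refine Finset.sum_congr rfl fun j _ => ?_
    rw [integral_smul_measure, integral_dirac, ENNReal.toReal_ofReal (hlam j), smul_eq_mul,
      Equiv.symm_apply_apply]
  · intro j _
    exact (integrable_dirac (by simp)).smul_measure ENNReal.ofReal_ne_top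

theorem measurable_of_finite_right (y : Fin N ≃ Y) {f : X × Y → ℝ}
    (hf : ∀ j, Measurable fun x => f (x, y j)) : Measurable f := by
  have : Finite Y := Finite.of_equiv _ y
  refine measurable_from_prod_countable_left fun z => ?_
  simpa using hf (y.symm z)

/-- A coupling onto `ν_λ` whose cost does not exceed the dual value touches the dual constraint
above every `y_j` with `λ^j > 0`. -/
theorem exists_eq_of_integral_le (μ : Measure X) [IsProbabilityMeasure μ] (y : Fin N ≃ Y)
    {c : X × Y → ℝ} (hc : Measurable c) {M : ℝ} (hM : ∀ z, |c z| ≤ M) {γ : Measure (X × Y)}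
    {lam : Fin N → ℝ} (hlam : ∀ j, 0 ≤ lam j) (hγ : γ ∈ couplings μ (targetMeasure y lam))
    {φ : X → ℝ} (hφ : Integrable φ μ) {ψ : Fin N → ℝ}
    (hadm : ∀ x j, -φ x - ψ j ≤ c (x, y j)) :
    -∫ x, φ x ∂μ - lam ⬝ᵥ ψ ≤ ∫ z, c z ∂γ ∧
      (∫ z, c z ∂γ ≤ -∫ x, φ x ∂μ - lam ⬝ᵥ ψ →
        ∀ j, 0 < lam j → ∃ x, -φ x - ψ j = c (x, y j)) := by
  have : Finite Y := Finite.of_equiv _ y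
  have hfin : IsFiniteMeasure γ := ⟨by
    have h := Measure.map_apply (μ := γ) measurable_fst MeasurableSet.univ
    rw [hγ.1, Set.preimage_univ] at h
    rw [← h]
    exact measure_lt_top _ _⟩
  have hφγ : Integrable (fun z => φ z.1) γ := by
    rw [← hγ.1] at hφ
    exact hφ.comp_measurable measurable_fst
  have hψm : Measurable fun z : Y => ψ (y.symm z) := measurable_of_finite _
  have hψγ : Integrable (fun z : X × Y => ψ (y.symm z.2)) γ := by
    obtain ⟨B, hB⟩ := (Set.finite_range fun j => |ψ j|).bddAbove
    exact Integrable.of_bound (hψm.comp measurable_snd).aestronglyMeasurable B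
      (.of_forall fun z => hB ⟨_, rfl⟩)
  have hcγ : Integrable c γ := Integrable.of_bound hc.aestronglyMeasurable M (.of_forall hM)
  have e1 : ∫ z, φ z.1 ∂γ = ∫ x, φ x ∂μ := by
    have h := hφ.1
    rw [← hγ.1] at h ⊢
    exact (integral_map measurable_fst.aemeasurable h).symm
  have e2 : ∫ z, ψ (y.symm z.2) ∂γ = lam ⬝ᵥ ψ := by
    rw [← integral_targetMeasure y hlam ψ, ← hγ.2]
    exact (integral_map measurable_snd.aemeasurable hψm.aestronglyMeasurable).symm
  -- The slack of the dual constraint: its `γ`-integral is the gap between the two sides of weak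
  -- duality.
  set g : X × Y → ℝ := fun z => c z + φ z.1 + ψ (y.symm z.2) with hg
  have hg0 : 0 ≤ g := fun z => by
    have := hadm z.1 (y.symm z.2)
    rw [Equiv.apply_symm_apply] at this
    simp only [hg, Pi.zero_apply]
    linarith
  have hgi : Integrable g γ := (hcγ.add hφγ).add hψγ
  have e3 : ∫ z, g z ∂γ = ∫ z, c z ∂γ + ∫ x, φ x ∂μ + lam ⬝ᵥ ψ := by
    rw [← e1, ← e2, ← integral_add hcγ hφγ]
    exact integral_add (hcγ.add hφγ) hψγ
  refine ⟨by linarith [integral_nonneg (μ := γ) hg0], fun hle j hj => ?_⟩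
  have hz : ∫ z, g z ∂γ = 0 := le_antisymm (by linarith) (integral_nonneg hg0)
  rw [integral_eq_zero_iff_of_nonneg hg0 hgi] at hz
  by_contra! hno
  -- Without contact above `y j`, the whole fibre lies in the null set `g ≠ 0`, although its
  -- `γ`-mass is `lam j > 0`.
  have hnull : γ (Prod.snd ⁻¹' {y j}) = 0 := by
    refine measure_mono_null (fun z hzj => ?_) (ae_iff.1 hz)
    have hzj' : z.2 = y j := hzj
    intro h0
    refine hno z.1 ?_
    have h0' : c z + φ z.1 + ψ (y.symm z.2) = 0 := h0
    rw [hzj', Equiv.symm_apply_apply] at h0'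
    rw [← hzj']
    linarith
  rw [← Measure.map_apply measurable_snd (measurableSet_singleton _), hγ.2, targetMeasure,
    Measure.finsetSum_apply, Finset.sum_eq_zero_iff] at hnull
  have h := hnull j (Finset.mem_univ j)
  rw [Measure.smul_apply, Measure.dirac_apply' _ (measurableSet_singleton _)] at h
  simp at h
  linarith

end Coupling

end StorageFee

/-! ### The main theorem -/

theorem mainTheorem2 {X Y : Type*} {N : ℕ}
    [TopologicalSpace X] [CompactSpace X] [TopologicalSpace.MetrizableSpace X]
    [MeasurableSpace X] [BorelSpace X]
    [MeasurableSpace Y] [MeasurableSingletonClass Y]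
    (μ : MeasureTheory.Measure X) [MeasureTheory.IsProbabilityMeasure μ]
    (y : Fin N ≃ Y)
    (c : X × Y → ℝ) (hc : ∀ j, Continuous fun x => c (x, y j))
    (F : (Fin N → ℝ) → EReal)
    (hF_convex : StorageFee.IsConvex F) (hF_proper : StorageFee.IsProper F)
    (hF_dom : ∀ lam, lam ∉ stdSimplex ℝ (Fin N) → F lam = ⊤)
    (γ : MeasureTheory.Measure (X × Y)) (lam : Fin N → ℝ)
    (hprimal : StorageFee.IsPrimalMinimizer μ y c F γ lam)
    (φ : C(X, ℝ)) (ψ : Fin N → ℝ)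
    (hdual : StorageFee.IsDualMaximizer μ y c F φ ψ) :
    -StorageFee.legendre F ψ = ((-(lam ⬝ᵥ ψ) : ℝ) : EReal) + F lam ∧
      ∀ j, 0 < lam j →
        ψ j = StorageFee.cTransform c y (StorageFee.cStarTransform c y ψ) j := by
  obtain ⟨M, hM⟩ : ∃ M, ∀ z, |c z| ≤ M := by
    choose B hB using fun j => isCompact_univ.exists_bound_of_continuousOn (hc j).continuousOn
    obtain ⟨M, hM⟩ := (Set.finite_range B).bddAbove
    refine ⟨M, fun z => ?_⟩
    have := hB (y.symm z.2) z.1 trivial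
    rw [Equiv.apply_symm_apply] at this
    exact this.trans (hM ⟨_, rfl⟩)
  have hcm : Measurable c := StorageFee.measurable_of_finite_right y fun j => (hc j).measurable
  obtain ⟨⟨hlam, hγ⟩, hmin⟩ := hprimal
  obtain ⟨hadm, hmax⟩ := hdual
  have hplan : ∀ h : Fin N → X → ℝ, StorageFee.IsPlan h → ∀ t : ℝ, F (StorageFee.mass μ h) ≤ t →
      ((∫ z, c z ∂γ : ℝ) : EReal) + F lam ≤
        ((StorageFee.cost μ (fun j x => c (x, y j)) h + t : ℝ) : EReal) := by
    intro h hh t ht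
    have h1 : ((∫ z, c z ∂γ : ℝ) : EReal) + F lam ≤
        ((∫ z, c z ∂StorageFee.planMeasure μ y h : ℝ) : EReal) + F (StorageFee.mass μ h) :=
      hmin (a := (StorageFee.planMeasure μ y h, StorageFee.mass μ h))
        ⟨hh.mass_mem_stdSimplex μ, hh.planMeasure_mem_couplings μ y⟩
    rw [hh.integral_planMeasure μ y hcm hM] at h1
    rw [EReal.coe_add]
    exact h1.trans (add_le_add le_rfl ht)
  have hFtop : F lam ≠ ⊤ := by
    obtain ⟨l₀, hl₀⟩ := hF_proper.2
    have hl₀s : l₀ ∈ stdSimplex ℝ (Fin N) := by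
      by_contra hne
      exact hl₀ (hF_dom l₀ hne)
    -- A constant plan with weights `l₀` has finite value, so the minimum is not `⊤`.
    intro htop
    have h1 := hplan _ (StorageFee.isPlan_const hl₀s) (F l₀).toReal (by
      have hm : StorageFee.mass μ (fun j (_ : X) => l₀ j) = l₀ := by
        ext j
        simp [StorageFee.mass]
      rw [hm]
      exact EReal.le_coe_toReal hl₀)
    rw [htop, EReal.coe_add_top, top_le_iff] at h1
    exact EReal.coe_ne_top _ h1
  have hF : F lam = ((F lam).toReal : EReal) := (EReal.coe_toReal hFtop (hF_proper.1 lam)).symm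
  set f := (F lam).toReal with hf
  obtain ⟨q, hq, hqP⟩ := StorageFee.exists_dualAdmissible_le μ y hc hM hF_convex hF_proper hF_dom
    (P := ∫ z, c z ∂γ + f) (fun h hh t ht => by
      have := hplan h hh t ht
      rw [hF] at this
      exact_mod_cast this)
  have hval : ((∫ z, c z ∂γ + f : ℝ) : EReal) ≤
      ((-∫ x, φ x ∂μ : ℝ) : EReal) - StorageFee.legendre F ψ := hqP.trans (hmax hq)
  have hlower : ((lam ⬝ᵥ ψ - f : ℝ) : EReal) ≤ StorageFee.legendre F ψ := by
    rw [EReal.coe_sub, ← hF]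
    exact le_iSup (fun l : Fin N → ℝ => ((l ⬝ᵥ ψ : ℝ) : EReal) - F l) lam
  have hLtop : StorageFee.legendre F ψ ≠ ⊤ := fun h => by
    rw [h, EReal.sub_top, le_bot_iff] at hval
    exact EReal.coe_ne_bot _ hval
  have hLbot : StorageFee.legendre F ψ ≠ ⊥ := fun h => by
    rw [h, le_bot_iff] at hlower
    exact EReal.coe_ne_bot _ hlower
  have hL := (EReal.coe_toReal hLtop hLbot).symm
  set L := (StorageFee.legendre F ψ).toReal
  rw [hL, ← EReal.coe_sub, EReal.coe_le_coe_iff] at hval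
  rw [hL, EReal.coe_le_coe_iff] at hlower
  obtain ⟨hweak, htouch⟩ := StorageFee.exists_eq_of_integral_le μ y hcm hM hlam.1 hγ
    (φ := φ) (φ.continuous.integrable_of_hasCompactSupport (HasCompactSupport.of_compactSpace _))
    hadm
  -- `hval`, `hlower` and `hweak` close into a cycle, so all three are equalities.
  refine ⟨?_, fun j hj => ?_⟩
  · rw [hL, hF, ← EReal.coe_neg, ← EReal.coe_add, EReal.coe_eq_coe_iff]
    linarith
  · obtain ⟨x, hx⟩ := htouch (by linarith) j hj
    exact StorageFee.eq_cTransform_cStarTransform hadm hx
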